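/- Consider $n \ge 1$ sporadic tasks $\tau_1,\dots,\tau_n$, indexed by decreasing priority, under fixed-priority preemptive scheduling on one processor in continuous time (jobs of the same task are prioritized by release order). Task $\tau_i$ has minimum inter-arrival time $T_i>0$. The tasks $\tau_1,\dots,\tau_{n-1}$ are ordinary: each job of $\tau_i$ is a single computation segment of worst-case execution time $C_i>0$. The lowest-priority task $\tau_n$ is segmented self-suspending: each of its jobs consists of $m\ge 2$ computation segments with worst-case execution times $C_n^1,\dots,C_n^m>0$, separated by suspension intervals of worst-case lengths $S_n^1,\dots,S_n^{m-1}\ge 0$. A valid release pattern consists, for each task, of a (finite or infinite) set of release times in $[0,\infty)$, any two releases of $\tau_i$ being at least $T_i$ apart, and of actual execution and suspension times of the released jobs, which are nonnegative and at most their worst-case values. For a job $J$ of $\tau_n$, the arrival time $g_1$ of its first segment is its release time, $f_j\in\mathbb{R}\cup\{\infty\}$ is the finishing time of its $j$-th segment, and the arrival time $g_{j+1}$ is $f_j$ plus the actual length of the $j$-th suspension; the response time of $J$ is $f_m-g_1$. Let $WCRT_n\in[0,\infty]$ be the supremum of the response times of all jobs of $\tau_n$ over all valid release patterns. Call a valid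 release pattern critical for a job $J$ of $\tau_n$ if $J$ is the only job of $\tau_n$ that is released and 1. the tasks $\tau_1,\dots,\tau_{n-1}$ release jobs only at times in $\bigcup_{j=1}^m [g_j,f_j)$; 2. $g_{j+1}-f_j=S_n^j$ for $j=1,\dots,m-1$; 3. all jobs are executed with their worst-case execution times. Then: (a) If $WCRT_n\le T_n$, then $WCRT_n$ is attained by a critical release pattern: it is the maximum of the response times of $J$ over all jobs $J$ and all release patterns that are critical for $J$. (b) If $WCRT_n>T_n$, then there are a job $J$ and a release pattern critical for $J$ in which the response time of $J$ is finite and larger than $T_n$. -/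

import Mathlib

open MeasureTheory

/-- A system of `n` segmented self-suspending sporadic tasks, indexed by decreasing priority
(index `0` is the highest priority). Task `i` has `seg i` computation segments, numbered from
`0`, with worst-case execution times `C i j` (`j < seg i`); `S i j` (`j + 1 < seg i`) is the
worst-case length of the suspension interval between segments `j` and `j + 1`; `T i` is the
minimum inter-arrival time. An ordinary sporadic task is a task with `seg i = 1`. -/
structure TaskSystem (n : ℕ) where
  seg : Fin n → ℕ
  C : Fin n → ℕ → ℝ
  S : Fin n → ℕ → ℝ
  T : Fin n → ℝ
  seg_pos : ∀ i, 0 < seg i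
  C_pos : ∀ i j, j < seg i → 0 < C i j
  S_nonneg : ∀ i j, j + 1 < seg i → 0 ≤ S i j
  T_pos : ∀ i, 0 < T i

/-- A job is identified by its task and its release time (two jobs of one task are never
released at the same time, because minimum inter-arrival times are positive). -/
abbrev Job (n : ℕ) := Fin n × ℝ

/-- A release pattern: the release times of every task, and, for the job of task `i` released
at `r`, the actual execution time `exec i r j` of its segment `j` and the actual length
`susp i r j` of its suspension interval between the segments `j` and `j + 1`. -/
structure ReleasePattern (n : ℕ) where
  releases : Fin n → Set ℝ
  exec : Fin n → ℝ → ℕ → ℝ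
  susp : Fin n → ℝ → ℕ → ℝ

namespace ReleasePattern

variable {n : ℕ}

/-- The pattern respects the minimum inter-arrival times, the worst-case execution times and
the worst-case suspension times; time starts at `0`. -/
structure Valid (A : TaskSystem n) (P : ReleasePattern n) : Prop where
  release_nonneg : ∀ i, ∀ r ∈ P.releases i, 0 ≤ r
  separation : ∀ i, ∀ r ∈ P.releases i, ∀ r' ∈ P.releases i, r < r' → A.T i ≤ r' - r
  exec_mem : ∀ i, ∀ r ∈ P.releases i, ∀ j, j < A.seg i →
    0 ≤ P.exec i r j ∧ P.exec i r j ≤ A.C i j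
  susp_mem : ∀ i, ∀ r ∈ P.releases i, ∀ j, j + 1 < A.seg i →
    0 ≤ P.susp i r j ∧ P.susp i r j ≤ A.S i j

end ReleasePattern

/-- A uniprocessor schedule: `σ t` is the job executing at time `t`, `none` when idle. -/
abbrev Schedule (n : ℕ) := ℝ → Option (Job n)

section Timing

variable {n : ℕ}

/-- The amount of processor time that job `J` receives in `[a, x)`. -/
noncomputable def service (σ : Schedule n) (J : Job n) (a : EReal) (x : ℝ) : ENNReal :=
  volume {u : ℝ | a ≤ (u : EReal) ∧ u < x ∧ σ u = some J}

/-- The first time by which job `J` has received `e` units of processor time from time `a`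
on; it is `⊤` if this never happens. -/
noncomputable def finishFrom (σ : Schedule n) (J : Job n) (a : EReal) (e : ℝ) : EReal :=
  sInf {t : EReal | ∃ x : ℝ, t = (x : EReal) ∧ a ≤ (x : EReal) ∧
    ENNReal.ofReal e ≤ service σ J a x}

/-- The arrival time `g_j` of segment `j` of job `J`: the release time of the job for the first
segment; for a later one, the finishing time of the preceding segment plus the length of the
suspension interval in between. -/
noncomputable def segArrival (P : ReleasePattern n) (σ : Schedule n) (J : Job n) : ℕ → EReal
  | 0 => (J.2 : EReal)
  | j + 1 => finishFrom σ J (segArrival P σ J j) (P.exec J.1 J.2 j) + (P.susp J.1 J.2 j : EReal)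

/-- The finishing time `f_j` of segment `j` of job `J`. -/
noncomputable def segFinish (P : ReleasePattern n) (σ : Schedule n) (J : Job n) (j : ℕ) : EReal :=
  finishFrom σ J (segArrival P σ J j) (P.exec J.1 J.2 j)

/-- Job `J` is ready at time `t`: it is released, and one of its segments has arrived and is not
yet finished. -/
def Ready (A : TaskSystem n) (P : ReleasePattern n) (σ : Schedule n) (J : Job n) (t : ℝ) : Prop :=
  J.2 ∈ P.releases J.1 ∧
    ∃ j, j < A.seg J.1 ∧ segArrival P σ J j ≤ (t : EReal) ∧ (t : EReal) < segFinish P σ J j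

/-- `J` has priority over `J'`: its task has higher priority, or both are jobs of the same task
and `J` was released earlier. -/
def HasPriority (J J' : Job n) : Prop :=
  J.1 < J'.1 ∨ (J.1 = J'.1 ∧ J.2 < J'.2)

/-- `σ` is the fixed-priority preemptive schedule of the release pattern `P`: at every time the
processor executes the ready job of highest priority, and it idles only if no job is ready. -/
structure IsFPSchedule (A : TaskSystem n) (P : ReleasePattern n) (σ : Schedule n) : Prop where
  measurable : ∀ J, MeasurableSet {t : ℝ | σ t = some J}
  runs_iff : ∀ t J, σ t = some J ↔
    Ready A P σ J t ∧ ∀ J', Ready A P σ J' t → J' ≠ J → HasPriority J J'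

/-- The response time of job `J`: finishing time of its last segment minus release time; it is
`⊤` if the job never finishes. -/
noncomputable def responseTime (A : TaskSystem n) (P : ReleasePattern n) (σ : Schedule n)
    (J : Job n) : EReal :=
  segFinish P σ J (A.seg J.1 - 1) - (J.2 : EReal)

/-- The worst-case response time of task `i`: the supremum of the response times of its jobs
over all valid release patterns. -/
noncomputable def WCRT (A : TaskSystem n) (i : Fin n) : EReal :=
  sSup {x : EReal | ∃ (P : ReleasePattern n) (σ : Schedule n) (r : ℝ), P.Valid A ∧
    IsFPSchedule A P σ ∧ r ∈ P.releases i ∧ x = responseTime A P σ (i, r)}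

/-- The release pattern `P` with schedule `σ` is critical for the job of task `i` released at
`r`. The arrival and finishing times in `higher_released` and `suspension` are those of the
segments of that job. -/
structure IsCritical (A : TaskSystem n) (P : ReleasePattern n) (σ : Schedule n)
    (i : Fin n) (r : ℝ) : Prop where
  valid : P.Valid A
  schedule : IsFPSchedule A P σ
  only_job : P.releases i = {r}
  /-- Higher-priority jobs are released only within the intervals `[g_j, f_j)`. -/
  higher_released : ∀ i', i' < i → ∀ x ∈ P.releases i', ∃ j, j < A.seg i ∧
    segArrival P σ (i, r) j ≤ (x : EReal) ∧ (x : EReal) < segFinish P σ (i, r) j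
  /-- Every suspension has its worst-case length. -/
  suspension : ∀ j, j + 1 < A.seg i →
    segArrival P σ (i, r) (j + 1) - segFinish P σ (i, r) j = (A.S i j : EReal)
  /-- All jobs run for their worst-case execution times. -/
  worst_exec : ∀ i', ∀ x ∈ P.releases i', ∀ j, j < A.seg i' → P.exec i' x j = A.C i' j

end Timing

/-! ### Processor time received by a job, and first-passage times of it. -/

section Service

variable {n : ℕ} {σ : Schedule n} {J : Job n}

/-! Take a job `J` of the lowest-priority task, released at `r`, such that all earlier jobs of that
task are finished by `r`, and a real time `t` not after its completion. Call a time clear if no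
higher-priority job released before it is still pending. Truncate all `g_j`, `f_j` at `t`, let `a_j`
be the last clear time not after `g_j`, and end the `j`-th window at `b_j = min (f_j, a_{j+1})` (at
`f_j` for the last segment). On `[a_j, b_j)` the processor only runs segment `j` and higher-priority
jobs released since `a_j`, so the elapsed time stays strictly below `C_j` plus the demand released
so far. Consecutive windows are at most `S_j` apart. This is `exists_isCritical_of_le_segFinish`.

Next, each window is translated to a start `s_j` and given length `l_j = C_j` + demand of the
window, with a gap of exactly `S_j` after it. Since `l_j ≥ b_j - a_j`, the shifts `s_j - a_j` are
nondecreasing, so inter-arrival distances never shrink. In the resulting pattern segment `j`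
occupies exactly `[s_j, s_j + l_j)`, so the pattern is critical, with response time at least `t - r`
(`exists_isCritical_of_windows`, resting on `segArrival_eq_of_windows`).

The new response time is a constant plus a natural-number combination of the `C_i`. Only finitely
many such values are at most `T_n`, which gives a maximum in (a). In (b) the construction is applied
to the first job whose response time exceeds `T_n`; its predecessors are finished by its release. -/

theorem service_coe (a x : ℝ) :
    service σ J (a : EReal) x = volume (Set.Ico a x ∩ {u | σ u = some J}) := by
  unfold service
  congr 1
  ext u
  simp [and_assoc]

theorem service_mono (a : EReal) {x y : ℝ} (h : x ≤ y) : service σ J a x ≤ service σ J a y :=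
  measure_mono fun _ hu => ⟨hu.1, hu.2.1.trans_le h, hu.2.2⟩

theorem service_le_add (a x y : ℝ) :
    service σ J a y ≤ service σ J a x + ENNReal.ofReal (y - x) := by
  rw [service_coe, service_coe, ← Real.volume_Ico]
  refine (measure_mono ?_).trans (measure_union_le _ _)
  rintro u ⟨⟨h1, h2⟩, h3⟩
  by_cases h : u < x
  · exact Or.inl ⟨⟨h1, h⟩, h3⟩
  · exact Or.inr ⟨not_lt.1 h, h2⟩

theorem service_eq_zero {a x : ℝ} (h : x ≤ a) : service σ J a x = 0 := by
  rw [service_coe, Set.Ico_eq_empty (not_lt.2 h), Set.empty_inter, measure_empty]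

theorem service_ne_top (a x : ℝ) : service σ J a x ≠ ⊤ := by
  have h := service_le_add (σ := σ) (J := J) a a x
  rw [service_eq_zero le_rfl, zero_add] at h
  exact ne_top_of_le_ne_top ENNReal.ofReal_ne_top h

theorem le_finishFrom (a : EReal) (e : ℝ) : a ≤ finishFrom σ J a e := by
  refine le_sInf ?_
  rintro t ⟨x, rfl, hx, -⟩
  exact hx

/-- The infimum is attained because service grows at rate at most one: if only `v < e` units have
been received at `x`, the goal cannot be reached before `x + (e - v)`. -/
theorem finishFrom_le_iff {a x e : ℝ} (hax : a ≤ x) :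
    finishFrom σ J a e ≤ x ↔ ENNReal.ofReal e ≤ service σ J a x := by
  refine ⟨fun h => ?_, fun h => sInf_le ⟨x, rfl, EReal.coe_le_coe_iff.2 hax, h⟩⟩
  by_contra! hlt
  set v := (service σ J a x).toReal with hv
  have hvs : service σ J a x = ENNReal.ofReal v := (ENNReal.ofReal_toReal (service_ne_top a x)).symm
  have hv0 : 0 ≤ v := ENNReal.toReal_nonneg
  have hve : v < e := by
    rw [hvs] at hlt
    exact (ENNReal.ofReal_lt_ofReal_iff_of_nonneg hv0).1 hlt
  have key : ((x + (e - v) : ℝ) : EReal) ≤ finishFrom σ J a e := by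
    refine le_sInf ?_
    rintro t ⟨y, rfl, hy, hey⟩
    rw [EReal.coe_le_coe_iff]
    have hxy : x ≤ y := by
      by_contra! hyx
      exact absurd (hey.trans (service_mono _ hyx.le)) (not_le.2 hlt)
    have h2 := hey.trans (service_le_add a x y)
    rw [hvs, ← ENNReal.ofReal_add hv0 (sub_nonneg.2 hxy),
      ENNReal.ofReal_le_ofReal_iff (by linarith)] at h2
    linarith
  have := EReal.coe_le_coe_iff.1 (key.trans h)
  linarith

theorem lt_finishFrom_iff {a x e : ℝ} (hax : a ≤ x) :
    (x : EReal) < finishFrom σ J a e ↔ service σ J a x < ENNReal.ofReal e := by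
  rw [← not_le, finishFrom_le_iff hax, not_le]

/-- Strictly before the finishing time the service is below `e`; the rate bound carries this to the
endpoint up to an arbitrary `ε`. -/
theorem service_le_of_le_finishFrom {a z e : ℝ} (h : (z : EReal) ≤ finishFrom σ J a e) :
    service σ J a z ≤ ENNReal.ofReal e := by
  rcases le_or_gt z a with hza | haz
  · rw [service_eq_zero hza]; exact zero_le
  refine ENNReal.le_of_forall_pos_le_add fun ε hε _ => ?_
  have hε' : (0 : ℝ) < ε := hε
  have hw : max a (z - ε) < z := max_lt haz (by linarith)
  have h1 := (lt_finishFrom_iff (le_max_left a (z - ε))).1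
    ((EReal.coe_lt_coe_iff.2 hw).trans_le h)
  refine (service_le_add a (max a (z - ε)) z).trans (add_le_add h1.le ?_)
  rw [← ENNReal.ofReal_coe_nnreal]
  exact ENNReal.ofReal_le_ofReal (by linarith [le_max_right a (z - ε)])

theorem finishFrom_top (e : ℝ) : finishFrom σ J ⊤ e = ⊤ := top_le_iff.1 (le_finishFrom ⊤ e)

end Service

/-! ### Order of segment times, local finiteness of releases, and the running job. -/

section Segments

variable {n : ℕ} {A : TaskSystem n} {P : ReleasePattern n} {σ : Schedule n}

theorem segArrival_le_segFinish (J : Job n) (j : ℕ) : segArrival P σ J j ≤ segFinish P σ J j :=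
  le_finishFrom _ _

theorem segArrival_succ (J : Job n) (j : ℕ) :
    segArrival P σ J (j + 1) = segFinish P σ J j + (P.susp J.1 J.2 j : EReal) := rfl

theorem segFinish_le_segArrival_succ (hP : P.Valid A) {J : Job n} (hJ : J.2 ∈ P.releases J.1)
    {j : ℕ} (hj : j + 1 < A.seg J.1) : segFinish P σ J j ≤ segArrival P σ J (j + 1) := by
  rw [segArrival_succ]
  exact le_add_of_nonneg_right (EReal.coe_nonneg.2 (hP.susp_mem _ _ hJ j hj).1)

theorem segFinish_mono (hP : P.Valid A) {J : Job n} (hJ : J.2 ∈ P.releases J.1)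
    {j j' : ℕ} (h : j ≤ j') (hj' : j' < A.seg J.1) : segFinish P σ J j ≤ segFinish P σ J j' := by
  induction j', h using Nat.le_induction with
  | base => exact le_rfl
  | succ l _ ih =>
    exact (ih (by omega)).trans ((segFinish_le_segArrival_succ hP hJ hj').trans
      (segArrival_le_segFinish J _))

theorem release_le_segArrival (hP : P.Valid A) {J : Job n} (hJ : J.2 ∈ P.releases J.1)
    {j : ℕ} (hj : j < A.seg J.1) : (J.2 : EReal) ≤ segArrival P σ J j := by
  induction j with
  | zero => exact le_rfl
  | succ l ih =>
    exact (ih (by omega)).trans ((segArrival_le_segFinish J l).trans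
      (segFinish_le_segArrival_succ hP hJ hj))

/-- Releases at least `T i` apart have distinct values of `⌊x / T i⌋`, and these integers are
bounded. -/
theorem ReleasePattern.Valid.finite_releases (hP : P.Valid A) (i : Fin n) (b : ℝ) :
    (P.releases i ∩ Set.Iic b).Finite := by
  have hT := A.T_pos i
  refine Set.Finite.of_finite_image (f := fun x => ⌊x / A.T i⌋)
    ((Set.finite_Icc (0 : ℤ) ⌊b / A.T i⌋).subset ?_) ?_
  · rintro _ ⟨x, ⟨hx, hxb⟩, rfl⟩
    exact ⟨Int.floor_nonneg.2 (div_nonneg (hP.release_nonneg i x hx) hT.le),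
      Int.floor_le_floor (div_le_div_of_nonneg_right hxb hT.le)⟩
  · have key : ∀ x ∈ P.releases i, ∀ y ∈ P.releases i, x < y →
        ⌊x / A.T i⌋ < ⌊y / A.T i⌋ := by
      intro x hx y hy hxy
      have h := hP.separation i x hx y hy hxy
      rw [← Int.add_one_le_iff, Int.le_floor]
      push_cast
      have h1 := Int.floor_le (x / A.T i)
      have h2 : x / A.T i + 1 ≤ y / A.T i := by
        rw [div_add_one hT.ne']
        exact div_le_div_of_nonneg_right (by linarith) hT.le
      linarith
    rintro x ⟨hx, -⟩ y ⟨hy, -⟩ hxy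
    rcases lt_trichotomy x y with h | h | h
    · exact absurd hxy (key x hx y hy h).ne
    · exact h
    · exact absurd hxy (key y hy x hx h).ne'

theorem hasPriority_iff {J J' : Job n} : HasPriority J J' ↔ toLex J < toLex J' := by
  rw [Prod.Lex.toLex_lt_toLex]
  rfl

theorem HasPriority.asymm {J J' : Job n} (h : HasPriority J J') : ¬ HasPriority J' J := by
  rw [hasPriority_iff] at *
  exact h.asymm

theorem exists_highest_priority {s : Set (Job n)} (hs : s.Finite) {J : Job n} (hJ : J ∈ s) :
    ∃ J₀ ∈ s, (∀ J' ∈ s, J' ≠ J₀ → HasPriority J₀ J') ∧ (J₀ = J ∨ HasPriority J₀ J) := by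
  obtain ⟨J₀, h₀, hmin⟩ := Set.exists_min_image s toLex hs ⟨J, hJ⟩
  have key : ∀ J' ∈ s, J' ≠ J₀ → HasPriority J₀ J' := fun J' h' hne => by
    rw [hasPriority_iff]
    exact lt_of_le_of_ne (hmin J' h') fun h => hne (toLex.injective h).symm
  refine ⟨J₀, h₀, key, ?_⟩
  by_cases h : J = J₀
  · exact Or.inl h.symm
  · exact Or.inr (key J hJ h)

theorem Ready.release_le (hP : P.Valid A) {J : Job n} {t : ℝ} (h : Ready A P σ J t) : J.2 ≤ t := by
  obtain ⟨hJ, j, hj, h1, -⟩ := h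
  exact EReal.coe_le_coe_iff.1 ((release_le_segArrival hP hJ hj).trans h1)

theorem finite_ready (hP : P.Valid A) (t : ℝ) : {J | Ready A P σ J t}.Finite := by
  refine (Set.finite_iUnion fun i => (hP.finite_releases i t).image (Prod.mk i)).subset ?_
  rintro ⟨i, x⟩ h
  exact Set.mem_iUnion.2 ⟨i, x, ⟨h.1, h.release_le hP⟩, rfl⟩

theorem IsFPSchedule.exists_running (hσ : IsFPSchedule A P σ) (hP : P.Valid A) {J : Job n} {t : ℝ}
    (h : Ready A P σ J t) :
    ∃ J', σ t = some J' ∧ Ready A P σ J' t ∧ (J' = J ∨ HasPriority J' J) := by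
  obtain ⟨J₀, h0, hmax, hor⟩ := exists_highest_priority (finite_ready hP t) h
  exact ⟨J₀, (hσ.runs_iff t J₀).2 ⟨h0, hmax⟩, h0, hor⟩

theorem ready_iff_of_seg_eq_one {J : Job n} (h : A.seg J.1 = 1) {t : ℝ} :
    Ready A P σ J t ↔ J.2 ∈ P.releases J.1 ∧ J.2 ≤ t ∧ (t : EReal) < segFinish P σ J 0 := by
  unfold Ready
  refine and_congr_right fun _ => ⟨?_, fun ⟨h1, h2⟩ => ⟨0, by omega, EReal.coe_le_coe_iff.2 h1, h2⟩⟩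
  rintro ⟨j, hj, h1, h2⟩
  obtain rfl : j = 0 := by omega
  exact ⟨EReal.coe_le_coe_iff.1 h1, h2⟩

/-- A single-segment job runs only between its release and its finishing time, where service is
capped by the execution time. -/
theorem volume_running_le (hσ : IsFPSchedule A P σ) {J : Job n} (h : A.seg J.1 = 1) (p q : ℝ) :
    volume (Set.Ico p q ∩ {u | σ u = some J}) ≤ ENNReal.ofReal (P.exec J.1 J.2 0) := by
  have hsub : ∀ u, σ u = some J → J.2 ≤ u ∧ (u : EReal) < segFinish P σ J 0 := fun u hu =>
    ((ready_iff_of_seg_eq_one h).1 ((hσ.runs_iff u J).1 hu).1).2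
  rcases le_or_gt (q : EReal) (segFinish P σ J 0) with hq | hq
  · refine le_trans ?_ (service_le_of_le_finishFrom hq)
    refine (measure_mono ?_).trans (service_coe (σ := σ) (J := J) J.2 q).ge
    exact fun u hu => ⟨⟨(hsub u hu.2).1, hu.1.2⟩, hu.2⟩
  · have hge : (J.2 : EReal) ≤ segFinish P σ J 0 := segArrival_le_segFinish J 0
    obtain ⟨f, hf⟩ : ∃ f : ℝ, segFinish P σ J 0 = f :=
      ⟨_, (EReal.coe_toReal (ne_top_of_lt hq)
        (ne_bot_of_le_ne_bot (EReal.coe_ne_bot _) hge)).symm⟩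
    refine le_trans ?_ (service_le_of_le_finishFrom (z := f) hf.ge)
    refine (measure_mono ?_).trans (service_coe (σ := σ) (J := J) J.2 f).ge
    refine fun u hu => ⟨⟨(hsub u hu.2).1, ?_⟩, hu.2⟩
    have := (hsub u hu.2).2
    rw [hf] at this
    exact EReal.coe_lt_coe_iff.1 this

end Segments

/-! ### Existence of the fixed-priority schedule for finitely many jobs. -/

section Existence

variable {n : ℕ} {A : TaskSystem n} {P : ReleasePattern n} {σ σ' : Schedule n} {J : Job n}

theorem finishFrom_eq_coe {a : ℝ} {e : ℝ} {b : EReal} (h : finishFrom σ J a e < b) :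
    ∃ f : ℝ, a ≤ f ∧ finishFrom σ J a e = f := by
  have hge := le_finishFrom (σ := σ) (J := J) a e
  have hf : ((finishFrom σ J a e).toReal : EReal) = finishFrom σ J a e :=
    EReal.coe_toReal (ne_top_of_lt h) (ne_bot_of_le_ne_bot (EReal.coe_ne_bot a) hge)
  refine ⟨_, ?_, hf.symm⟩
  rw [← hf] at hge
  exact EReal.coe_le_coe_iff.1 hge

/-- Agreement is needed only before the finishing time in `σ'`: the services coincide up to that
time, so the threshold is crossed at the same moment. -/
theorem finishFrom_congr {a : EReal} (ha : a ≠ ⊥) {e : ℝ}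
    (h : ∀ t : ℝ, a ≤ t → (t : EReal) < finishFrom σ' J a e → (σ t = some J ↔ σ' t = some J)) :
    finishFrom σ J a e = finishFrom σ' J a e := by
  induction a with
  | bot => exact absurd rfl ha
  | top => rw [finishFrom_top, finishFrom_top]
  | coe a =>
    have hserv : ∀ z : ℝ, (z : EReal) ≤ finishFrom σ' J a e →
        service σ J a z = service σ' J a z := by
      intro z hz
      rw [service_coe, service_coe]
      congr 1
      ext u
      simp only [Set.mem_inter_iff, Set.mem_ofPred_eq]
      exact and_congr_right fun hu => h u (EReal.coe_le_coe_iff.2 hu.1)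
        ((EReal.coe_lt_coe_iff.2 hu.2).trans_le hz)
    apply le_antisymm
    · by_contra! hlt
      obtain ⟨f, haf, hf⟩ := finishFrom_eq_coe hlt
      rw [hf, lt_finishFrom_iff haf, hserv f hf.ge] at hlt
      exact absurd ((finishFrom_le_iff haf).1 hf.le) (not_le.2 hlt)
    · by_contra! hlt
      obtain ⟨f, haf, hf⟩ := finishFrom_eq_coe hlt
      have h1 := (finishFrom_le_iff haf).1 hf.le
      rw [hf] at hlt
      rw [hserv f hlt.le] at h1
      exact absurd ((lt_finishFrom_iff haf).1 hlt) (not_lt.2 h1)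

theorem segArrival_ne_bot (j : ℕ) : segArrival P σ J j ≠ ⊥ := by
  induction j with
  | zero => exact EReal.coe_ne_bot _
  | succ j ih =>
    rw [segArrival_succ, Ne, EReal.add_eq_bot_iff, not_or]
    exact ⟨ne_bot_of_le_ne_bot ih (segArrival_le_segFinish J j), EReal.coe_ne_bot _⟩

theorem segArrival_congr {m : ℕ}
    (h : ∀ t : ℝ, ∀ j < m, segArrival P σ' J j ≤ t → (t : EReal) < segFinish P σ' J j →
      (σ t = some J ↔ σ' t = some J)) {j : ℕ} (hj : j < m) :
    segArrival P σ J j = segArrival P σ' J j ∧ segFinish P σ J j = segFinish P σ' J j := by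
  have key : ∀ j < m, segArrival P σ J j = segArrival P σ' J j →
      segFinish P σ J j = segFinish P σ' J j := by
    intro j hj hA
    unfold segFinish
    rw [hA]
    exact finishFrom_congr (segArrival_ne_bot j) fun t h1 h2 => h t j hj h1 h2
  induction j with
  | zero => exact ⟨rfl, key 0 hj rfl⟩
  | succ j ih =>
    have h1 : segArrival P σ J (j + 1) = segArrival P σ' J (j + 1) := by
      rw [segArrival_succ, segArrival_succ, (ih (by omega)).2]
    exact ⟨h1, key _ hj h1⟩

/-- Readiness of `J` depends on the schedule only through when `J` runs while ready. This breaks the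
circularity in the definition of a schedule. -/
theorem ready_congr (h : ∀ t : ℝ, Ready A P σ' J t → (σ t = some J ↔ σ' t = some J)) (t : ℝ) :
    Ready A P σ J t ↔ Ready A P σ' J t := by
  refine and_congr_right fun hJ => exists_congr fun j => and_congr_right fun hj => ?_
  have := segArrival_congr (P := P) (σ := σ) (σ' := σ') (J := J)
    (fun t j hj h1 h2 => h t ⟨hJ, j, hj, h1, h2⟩) hj
  rw [this.1, this.2]

theorem measurableSet_ready : MeasurableSet {t : ℝ | Ready A P σ J t} := by
  by_cases hJ : J.2 ∈ P.releases J.1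
  · have : {t : ℝ | Ready A P σ J t} = ⋃ j ∈ Finset.range (A.seg J.1), (fun t : ℝ => (t : EReal)) ⁻¹'
        Set.Ico (segArrival P σ J j) (segFinish P σ J j) := by
      ext t
      simp [Ready, hJ, and_left_comm]
    rw [this]
    exact Finset.measurableSet_biUnion _ fun j _ => measurable_coe_real_ereal measurableSet_Ico
  · have : {t : ℝ | Ready A P σ J t} = ∅ := by
      ext t
      simp [Ready, hJ, and_left_comm]
    rw [this]
    exact MeasurableSet.empty

open Classical in
-- A schedule is a fixed point, since readiness refers back to it. Jobs are added in order of
-- decreasing priority: a new lowest-priority job only fills idle time and leaves the readiness of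
-- the others unchanged.
theorem exists_schedule_on (A : TaskSystem n) (P : ReleasePattern n) (s : Finset (Job n)) :
    ∃ σ : Schedule n, (∀ J, MeasurableSet {t : ℝ | σ t = some J}) ∧
      ∀ t J, σ t = some J ↔ J ∈ s ∧ Ready A P σ J t ∧
        ∀ J' ∈ s, Ready A P σ J' t → J' ≠ J → HasPriority J J' := by
  induction s using Finset.induction_on_max_value (toLex : Job n → _) with
  | empty => exact ⟨fun _ => none, by simp, by simp⟩
  | insert J₀ s hJ₀ hmax ih =>
    obtain ⟨σ, hmeas, hσ⟩ := ih
    have hprio : ∀ J ∈ s, HasPriority J J₀ := fun J hJ => by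
      rw [hasPriority_iff]
      exact lt_of_le_of_ne (hmax J hJ) fun h => hJ₀ (toLex.injective h ▸ hJ)
    have hne : ∀ J ∈ s, J ≠ J₀ := fun J hJ h => hJ₀ (h ▸ hJ)
    have hnone : ∀ t, σ t = none ↔ ∀ J ∈ s, ¬ Ready A P σ J t := by
      intro t
      constructor
      · intro h J hJ hr
        obtain ⟨J₁, h1, h2, -⟩ := exists_highest_priority
          (s := {J | J ∈ s ∧ Ready A P σ J t})
          (s.finite_toSet.subset fun J h => h.1) ⟨hJ, hr⟩
        have := (hσ t J₁).2 ⟨h1.1, h1.2, fun J' h' hr' => h2 J' ⟨h', hr'⟩⟩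
        rw [h] at this
        exact absurd this (by simp)
      · intro h
        by_contra hn
        obtain ⟨J, hJ⟩ := Option.ne_none_iff_exists'.1 hn
        exact h J ((hσ t J).1 hJ).1 ((hσ t J).1 hJ).2.1
    -- `α` gives `J₀` all idle time, even when it is not ready. Its readiness can be read off from
    -- `α`, and `τ` then keeps only the idle times at which `J₀` is ready.
    set α : Schedule n := fun t => if σ t = none then some J₀ else none with hα
    set τ : Schedule n := fun t =>
      if σ t = none then (if Ready A P α J₀ t then some J₀ else none) else σ t with hτ
    have hσJ₀ : ∀ t, σ t ≠ some J₀ := fun t h => hJ₀ ((hσ t J₀).1 h).1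
    have hτ_ne : ∀ t J, J ≠ J₀ → (τ t = some J ↔ σ t = some J) := by
      intro t J hJ
      by_cases h : σ t = none
      · by_cases hr : Ready A P α J₀ t <;> simp [hτ, h, hr, hJ.symm]
      · simp [hτ, h]
    have hτ_J₀ : ∀ t, τ t = some J₀ ↔ σ t = none ∧ Ready A P α J₀ t := by
      intro t
      by_cases h : σ t = none
      · simp [hτ, h]
      · simp [hτ, h, hσJ₀ t]
    have hready_ne : ∀ t J, J ≠ J₀ → (Ready A P τ J t ↔ Ready A P σ J t) := fun t J hJ =>
      ready_congr (fun u _ => hτ_ne u J hJ) t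
    have hready_J₀ : ∀ t, Ready A P τ J₀ t ↔ Ready A P α J₀ t := by
      refine ready_congr fun u hu => ?_
      rw [hτ_J₀]
      simp only [hu, and_true]
      simp [hα]
    refine ⟨τ, fun J => ?_, fun t J => ?_⟩
    · by_cases hJ : J = J₀
      · subst hJ
        have h0 : {t | σ t = none} = (⋃ J ∈ s, {t | σ t = some J})ᶜ := by
          ext t
          simp only [Set.mem_ofPred_eq, Set.mem_compl_iff, Set.mem_iUnion, not_exists]
          constructor
          · intro h J _ h'
            rw [h] at h'
            exact absurd h' (by simp)
          · intro h
            by_contra hn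
            obtain ⟨J, hJ⟩ := Option.ne_none_iff_exists'.1 hn
            exact h J ((hσ t J).1 hJ).1 hJ
        simp only [hτ_J₀]
        refine MeasurableSet.inter ?_ measurableSet_ready
        change MeasurableSet {t | σ t = none}
        rw [h0]
        exact (Finset.measurableSet_biUnion _ fun J _ => hmeas J).compl
      · simp only [hτ_ne _ J hJ]
        exact hmeas J
    · by_cases hJ : J = J₀
      · subst hJ
        rw [hτ_J₀, hready_J₀, hnone]
        constructor
        · rintro ⟨h1, h2⟩
          refine ⟨Finset.mem_insert_self _ _, h2, fun J' hJ' hr hne' => ?_⟩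
          have hJ's := (Finset.mem_insert.1 hJ').resolve_left hne'
          exact absurd ((hready_ne t J' hne').1 hr) (h1 J' hJ's)
        · rintro ⟨-, h2, h3⟩
          refine ⟨fun J' hJ' hr => ?_, h2⟩
          exact (h3 J' (Finset.mem_insert_of_mem hJ') ((hready_ne t J' (hne J' hJ')).2 hr)
            (hne J' hJ')).asymm (hprio J' hJ')
      · rw [hτ_ne t J hJ, hσ, hready_ne t J hJ, Finset.mem_insert, or_iff_right hJ]
        refine and_congr_right fun hJs => and_congr_right fun _ => ?_
        constructor
        · intro h J' hJ' hr hne'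
          rcases Finset.mem_insert.1 hJ' with rfl | hs
          · exact hprio J hJs
          · exact h J' hs ((hready_ne t J' (hne J' hs)).1 hr) hne'
        · intro h J' hJ' hr hne'
          exact h J' (Finset.mem_insert_of_mem hJ') ((hready_ne t J' (hne J' hJ')).2 hr) hne'

theorem exists_isFPSchedule (A : TaskSystem n) (P : ReleasePattern n)
    (hfin : ∀ i, (P.releases i).Finite) : ∃ σ, IsFPSchedule A P σ := by
  have hs : {J : Job n | J.2 ∈ P.releases J.1}.Finite := by
    refine (Set.finite_iUnion fun i => (hfin i).image (Prod.mk i)).subset ?_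
    rintro ⟨i, x⟩ h
    exact Set.mem_iUnion.2 ⟨i, x, h, rfl⟩
  obtain ⟨σ, hmeas, hσ⟩ := exists_schedule_on A P hs.toFinset
  refine ⟨σ, hmeas, fun t J => (hσ t J).trans ?_⟩
  simp only [Set.Finite.mem_toFinset, Set.mem_ofPred_eq]
  exact ⟨fun h => ⟨h.2.1, fun J' hr => h.2.2 J' hr.1 hr⟩,
    fun h => ⟨h.1.1, h.1, fun J' _ hr => h.2 J' hr⟩⟩

end Existence

/-! ### Processor time against higher-priority demand. -/

section Interference

variable {k : ℕ} {A : TaskSystem (k + 1)} {P : ReleasePattern (k + 1)} {σ : Schedule (k + 1)}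
  {J : Job (k + 1)}

/-- The jobs of the tasks other than the lowest-priority one that are released in `[a, y)`. -/
def higherJobs (P : ReleasePattern (k + 1)) (a y : ℝ) : Set (Job (k + 1)) :=
  {J | J.1 < Fin.last k ∧ J.2 ∈ P.releases J.1 ∧ a ≤ J.2 ∧ J.2 < y}

/-- The worst-case amount of work released in `[a, y)` by the tasks other than the
lowest-priority one. -/
noncomputable def demand (A : TaskSystem (k + 1)) (P : ReleasePattern (k + 1)) (a y : ℝ) : ℝ :=
  ∑ᶠ J ∈ higherJobs P a y, A.C J.1 0

/-- No higher-priority job released before `t` is unfinished at time `t`. -/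
def Clear (P : ReleasePattern (k + 1)) (σ : Schedule (k + 1)) (t : ℝ) : Prop :=
  ∀ J : Job (k + 1), J.1 < Fin.last k → J.2 ∈ P.releases J.1 → J.2 < t → segFinish P σ J 0 ≤ t

theorem TaskSystem.C_zero_pos {n : ℕ} (A : TaskSystem n) (i : Fin n) : 0 < A.C i 0 :=
  A.C_pos i 0 (A.seg_pos i)

theorem finite_higherJobs (hP : P.Valid A) (a y : ℝ) : (higherJobs P a y).Finite := by
  refine (Set.finite_iUnion fun i => (hP.finite_releases i y).image (Prod.mk i)).subset ?_
  rintro ⟨i, x⟩ h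
  exact Set.mem_iUnion.2 ⟨i, x, ⟨h.2.1, h.2.2.2.le⟩, rfl⟩

theorem demand_eq_sum (hP : P.Valid A) (a y : ℝ) :
    demand A P a y = ∑ J ∈ (finite_higherJobs hP a y).toFinset, A.C J.1 0 :=
  finsum_mem_eq_finite_toFinset_sum _ _

theorem demand_nonneg (A : TaskSystem (k + 1)) (P : ReleasePattern (k + 1)) (a y : ℝ) :
    0 ≤ demand A P a y :=
  finsum_nonneg fun J => finsum_nonneg fun _ => (A.C_zero_pos J.1).le

theorem demand_mono (hP : P.Valid A) (a : ℝ) {x y : ℝ} (h : x ≤ y) :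
    demand A P a x ≤ demand A P a y := by
  rw [demand_eq_sum hP, demand_eq_sum hP]
  refine Finset.sum_le_sum_of_subset_of_nonneg (fun J hJ => ?_) fun J _ _ => (A.C_zero_pos J.1).le
  rw [Set.Finite.mem_toFinset] at *
  exact ⟨hJ.1, hJ.2.1, hJ.2.2.1, hJ.2.2.2.trans_le h⟩

/-- Since `a` is clear, a higher-priority job running in `(a, y)` was released in `[a, y)`, and each
such job takes at most its worst-case time. What remains of the busy interval is service to `J`. -/
theorem ofReal_sub_le_service_add_demand (hP : P.Valid A)
    (hhigh : ∀ i, i ≠ Fin.last k → A.seg i = 1) (hσ : IsFPSchedule A P σ) {a y g : ℝ}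
    (hclear : Clear P σ a)
    (hrun : ∀ u ∈ Set.Ioo a y, (∃ J' : Job (k + 1), J'.1 < Fin.last k ∧ σ u = some J') ∨
      (g ≤ u ∧ σ u = some J)) :
    ENNReal.ofReal (y - a) ≤ service σ J g y + ENNReal.ofReal (demand A P a y) := by
  rw [demand_eq_sum hP, ENNReal.ofReal_sum_of_nonneg fun J _ => (A.C_zero_pos J.1).le,
    ← Real.volume_Ioo, service_coe]
  set F := (finite_higherJobs hP a y).toFinset with hF
  have hsub : Set.Ioo a y ⊆ (Set.Ico g y ∩ {u | σ u = some J}) ∪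
      ⋃ J' ∈ F, (Set.Ico a y ∩ {u | σ u = some J'}) := by
    intro u hu
    rcases hrun u hu with ⟨J', hlt, hJ'⟩ | ⟨h1, h2⟩
    · right
      have hr := (ready_iff_of_seg_eq_one (hhigh _ hlt.ne)).1 ((hσ.runs_iff u J').1 hJ').1
      refine Set.mem_biUnion (x := J') ?_ ⟨⟨hu.1.le, hu.2⟩, hJ'⟩
      refine (Set.Finite.mem_toFinset _).2 ⟨hlt, hr.1, ?_, hr.2.1.trans_lt hu.2⟩
      by_contra! hlta
      exact absurd ((hr.2.2.trans_le (hclear J' hlt hr.1 hlta)).trans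
        (EReal.coe_lt_coe_iff.2 hu.1)) (lt_irrefl _)
    · exact Or.inl ⟨⟨h1, hu.2⟩, h2⟩
  refine (measure_mono hsub).trans ((measure_union_le _ _).trans (add_le_add le_rfl ?_))
  refine (measure_biUnion_finset_le _ _).trans (Finset.sum_le_sum fun J' hJ' => ?_)
  have hJ'' := (Set.Finite.mem_toFinset _).1 hJ'
  exact (volume_running_le hσ (hhigh _ hJ''.1.ne) a y).trans (ENNReal.ofReal_le_ofReal
    (hP.exec_mem _ _ hJ''.2.1 0 (A.seg_pos _)).2)

/-- The converse estimate: since `f` is clear, every higher-priority job released in `[s, f)` has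
also completed there, and different jobs occupy disjoint sets of times. -/
theorem service_add_demand_le (hP : P.Valid A) (hσ : IsFPSchedule A P σ)
    (hJ : J.1 = Fin.last k)
    (hexec : ∀ i < Fin.last k, ∀ x ∈ P.releases i, P.exec i x 0 = A.C i 0)
    {s f : ℝ} (hclear : Clear P σ f) :
    service σ J s f + ENNReal.ofReal (demand A P s f) ≤ ENNReal.ofReal (f - s) := by
  classical
  rw [demand_eq_sum hP, ENNReal.ofReal_sum_of_nonneg fun J _ => (A.C_zero_pos J.1).le,
    ← Real.volume_Ico, service_coe]
  set F := (finite_higherJobs hP s f).toFinset with hF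
  have hJF : J ∉ F := fun h => ((Set.Finite.mem_toFinset _).1 h).1.ne hJ
  have hvol : ∀ J' ∈ F, ENNReal.ofReal (A.C J'.1 0) ≤
      volume (Set.Ico s f ∩ {u | σ u = some J'}) := by
    intro J' hJ'
    have hm := (Set.Finite.mem_toFinset _).1 hJ'
    have h1 := (finishFrom_le_iff hm.2.2.2.le).1 (hclear J' hm.1 hm.2.1 hm.2.2.2)
    rw [hexec _ hm.1 _ hm.2.1, service_coe] at h1
    exact h1.trans (measure_mono fun u hu => ⟨⟨hm.2.2.1.trans hu.1.1, hu.1.2⟩, hu.2⟩)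
  refine (add_le_add le_rfl (Finset.sum_le_sum hvol)).trans ?_
  rw [← Finset.sum_insert (f := fun J' => volume (Set.Ico s f ∩ {u | σ u = some J'})) hJF,
    ← measure_biUnion_finset]
  · exact measure_mono (Set.iUnion₂_subset fun J' _ => Set.inter_subset_left)
  · intro J₁ _ J₂ _ hne
    refine Set.disjoint_left.2 fun u h1 h2 => hne ?_
    exact Option.some.inj (h1.2.symm.trans h2.2)
  · exact fun J' _ => measurableSet_Ico.inter (hσ.measurable J')

/-- A higher-priority job pending at `f` would have kept `J` from running since `max g J'.2 < f`, so
the segment would already have been finished then. Positive execution time is what gives `g < f`. -/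
theorem clear_of_segFinish_eq (hhigh : ∀ i, i ≠ Fin.last k → A.seg i = 1)
    (hσ : IsFPSchedule A P σ) (hJ : J.1 = Fin.last k) {j : ℕ} {g f : ℝ}
    (hg : segArrival P σ J j = g) (hf : segFinish P σ J j = f) (hpos : 0 < P.exec J.1 J.2 j) :
    Clear P σ f := by
  intro J' hlt hJ' hxf
  by_contra! hfin
  have hgf : g ≤ f := by
    have := segArrival_le_segFinish (P := P) (σ := σ) J j
    rw [hg, hf] at this
    exact EReal.coe_le_coe_iff.1 this
  unfold segFinish at hf
  rw [hg] at hf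
  have hserv := (finishFrom_le_iff hgf).1 hf.le
  have hgf' : g < f := by
    refine lt_of_le_of_ne hgf fun h => ?_
    rw [h, service_eq_zero le_rfl] at hserv
    exact absurd (ENNReal.ofReal_pos.2 hpos) (not_lt.2 hserv)
  set w := max g J'.2 with hw
  have hwf : w < f := max_lt hgf' hxf
  have hgw : g ≤ w := le_max_left _ _
  have heq : service σ J g f ≤ service σ J g w := by
    rw [service_coe, service_coe]
    refine measure_mono fun u hu => ⟨⟨hu.1.1, ?_⟩, hu.2⟩
    by_contra! hwu
    have hr : Ready A P σ J' u := (ready_iff_of_seg_eq_one (hhigh _ hlt.ne)).2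
      ⟨hJ', (le_max_right _ _).trans hwu, (EReal.coe_lt_coe_iff.2 hu.1.2).trans hfin⟩
    have hne : J' ≠ J := fun h => hlt.ne (h ▸ hJ)
    exact (((hσ.runs_iff u J).1 hu.2).2 J' hr hne).asymm (Or.inl (hJ ▸ hlt))
  have := (finishFrom_le_iff hgw).2 (hserv.trans heq)
  rw [hf] at this
  exact absurd (EReal.coe_le_coe_iff.1 this) (not_le.2 hwf)

end Interference

/-! ### Schedules in which each segment exactly fills a prescribed window. -/

section Windows

variable {k : ℕ} {A : TaskSystem (k + 1)} {P : ReleasePattern (k + 1)} {σ : Schedule (k + 1)}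

/-- If a sequence satisfies `s j + l j ≤ s (j + 1)` with `l ≥ 0`, then its windows
`[s j, s j + l j)` are ordered. -/
theorem add_le_of_lt_of_step {m : ℕ} {s l : ℕ → ℝ} (hl : ∀ j < m, 0 ≤ l j)
    (hstep : ∀ j, j + 1 < m → s j + l j ≤ s (j + 1)) {j j' : ℕ} (h : j < j') (hj' : j' < m) :
    s j + l j ≤ s j' := by
  induction j', h using Nat.le_induction with
  | base => exact hstep j hj'
  | succ i hi ih =>
    have := ih (by omega)
    have := hstep i hj'
    have := hl i (by omega)
    linarith

/-- By `hl` and `hlt`, `l j` is the least solution of the response-time equation of segment `j`. The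
induction carries along that each `s j` is clear, so that no backlog enters a window. -/
theorem segArrival_eq_of_windows (hP : P.Valid A) (hhigh : ∀ i, i ≠ Fin.last k → A.seg i = 1)
    (hσ : IsFPSchedule A P σ) {r : ℝ} (hrel : P.releases (Fin.last k) = {r})
    (hexec : ∀ i, ∀ x ∈ P.releases i, ∀ j, j < A.seg i → P.exec i x j = A.C i j)
    (hsusp : ∀ j, j + 1 < A.seg (Fin.last k) → P.susp (Fin.last k) r j = A.S (Fin.last k) j)
    {s l : ℕ → ℝ} (hs0 : s 0 = r)
    (hs : ∀ j, j + 1 < A.seg (Fin.last k) → s (j + 1) = s j + l j + A.S (Fin.last k) j)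
    (hl : ∀ j < A.seg (Fin.last k),
      l j = A.C (Fin.last k) j + demand A P (s j) (s j + l j))
    (hwin : ∀ i < Fin.last k, ∀ x ∈ P.releases i,
      ∃ j < A.seg (Fin.last k), s j ≤ x ∧ x < s j + l j)
    (hlt : ∀ j < A.seg (Fin.last k), ∀ x, s j ≤ x → x < s j + l j →
      x - s j < A.C (Fin.last k) j + demand A P (s j) x)
    {j : ℕ} (hj : j < A.seg (Fin.last k)) :
    segArrival P σ (Fin.last k, r) j = s j ∧
      segFinish P σ (Fin.last k, r) j = (s j + l j : ℝ) := by
  set J : Job (k + 1) := (Fin.last k, r) with hJ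
  set m := A.seg (Fin.last k) with hm
  have hr : r ∈ P.releases (Fin.last k) := by rw [hrel]; rfl
  have hlpos : ∀ j < m, 0 < l j := fun j hj => by
    rw [hl j hj]
    exact add_pos_of_pos_of_nonneg (A.C_pos _ _ hj) (demand_nonneg _ _ _ _)
  have hstep : ∀ j, j + 1 < m → s j + l j ≤ s (j + 1) := fun j hj => by
    rw [hs j hj]
    linarith [A.S_nonneg _ _ hj]
  have hord : ∀ {j j' : ℕ}, j < j' → j' < m → s j + l j ≤ s j' := fun h h' =>
    add_le_of_lt_of_step (fun j hj => (hlpos j hj).le) hstep h h'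
  have key : ∀ j < m, segArrival P σ J j = s j → Clear P σ (s j) →
      segFinish P σ J j = (s j + l j : ℝ) := by
    intro j hj harr hclear
    have hjr : s j ≤ s j + l j := by linarith [hlpos j hj]
    have hfin : segFinish P σ J j = finishFrom σ J (s j : ℝ) (A.C (Fin.last k) j) := by
      unfold segFinish
      rw [harr, hexec _ r hr j hj]
    -- Finishing early at `f` would make `f` clear, so the segment and all demand released so far
    -- would fit into `[s j, f)`, contrary to `hlt`.
    have hge : ((s j + l j : ℝ) : EReal) ≤ segFinish P σ J j := by
      by_contra! hcon
      rw [hfin] at hcon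
      obtain ⟨f, hsf, hf⟩ := finishFrom_eq_coe hcon
      rw [hf] at hcon
      have hcl : Clear P σ f := clear_of_segFinish_eq hhigh hσ rfl harr (hfin.trans hf)
        (by rw [hexec _ r hr j hj]; exact A.C_pos _ _ hj)
      have h1 := service_add_demand_le (J := J) (s := s j) hP hσ rfl
        (fun i _ x hx => hexec i x hx 0 (A.seg_pos i)) hcl
      have h2 := (add_le_add_left ((finishFrom_le_iff hsf).1 hf.le) _).trans h1
      rw [← ENNReal.ofReal_add (A.C_pos _ _ hj).le (demand_nonneg _ _ _ _),
        ENNReal.ofReal_le_ofReal_iff (by linarith)] at h2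
      exact absurd (hlt j hj f hsf (EReal.coe_lt_coe_iff.1 hcon)) (not_lt.2 h2)
    refine le_antisymm ?_ hge
    rw [hfin, finishFrom_le_iff hjr]
    have h1 := ofReal_sub_le_service_add_demand (J := J) (y := s j + l j) (g := s j)
      hP hhigh hσ hclear ?_
    · rw [add_sub_cancel_left] at h1
      conv at h1 => lhs; rw [hl j hj]
      rw [ENNReal.ofReal_add (A.C_pos _ _ hj).le (demand_nonneg _ _ _ _)] at h1
      exact (ENNReal.add_le_add_iff_right ENNReal.ofReal_ne_top).1 h1
    · intro u hu
      have hready : Ready A P σ J u := ⟨hr, j, hj, by rw [harr]; exact EReal.coe_le_coe_iff.2 hu.1.le,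
        (EReal.coe_lt_coe_iff.2 hu.2).trans_le hge⟩
      obtain ⟨J', hJ', hready', rfl | hpr⟩ := hσ.exists_running hP hready
      · exact Or.inr ⟨hu.1.le, hJ'⟩
      · rcases hpr with h | ⟨h, h'⟩
        · exact Or.inl ⟨J', h, hJ'⟩
        · have := hready'.1
          rw [h, hrel] at this
          exact absurd h' (by rw [Set.mem_singleton_iff.1 this]; exact lt_irrefl _)
  have main : ∀ j < m, segArrival P σ J j = s j ∧ Clear P σ (s j) := by
    intro j
    induction j with
    | zero =>
      refine fun h0 => ⟨by rw [hs0]; rfl, fun J' h1 h2 h3 => ?_⟩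
      obtain ⟨j', hj', h4, -⟩ := hwin _ h1 _ h2
      rcases Nat.eq_zero_or_pos j' with rfl | hpos
      · exact absurd h3 (not_lt.2 h4)
      · linarith [hord hpos hj', hlpos 0 h0]
    | succ j ih =>
      intro hj
      obtain ⟨harr, hcl⟩ := ih (by omega)
      have hfin := key j (by omega) harr hcl
      refine ⟨?_, fun J' h1 h2 h3 => ?_⟩
      · rw [segArrival_succ, hfin, hs j hj, ← hsusp j hj, ← EReal.coe_add]
      -- Releases before `s (j + 1)` lie in windows up to `j`, hence before `s j + l j`, which is
      -- clear as the finishing time of segment `j`.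
      · obtain ⟨j', hj', h4, h5⟩ := hwin _ h1 _ h2
        have hcl' : Clear P σ (s j + l j) := clear_of_segFinish_eq hhigh hσ rfl harr hfin
          (by rw [hexec _ r hr j (by omega)]; exact A.C_pos _ _ (by omega))
        refine (hcl' J' h1 h2 ?_).trans (EReal.coe_le_coe_iff.2 (hstep j hj))
        rcases lt_trichotomy j' j with h | h | h
        · linarith [hord h (by omega), hlpos j (by omega)]
        · rwa [h] at h5
        · rcases Nat.lt_or_eq_of_le (Nat.succ_le_of_lt h) with h' | h'
          · have h6 : j + 1 < j' := h'
            linarith [hord h6 hj', hlpos (j + 1) hj]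
          · have h6 : j + 1 = j' := h'
            rw [h6] at h3
            exact absurd h3 (not_lt.2 h4)
  exact ⟨(main j hj).1, key j hj (main j hj).1 (main j hj).2⟩

end Windows

/-! ### Building a critical pattern by moving windows apart. -/

section Shift

variable {k : ℕ} {A : TaskSystem (k + 1)} {P : ReleasePattern (k + 1)}

/-- Grouping the jobs by task; used to confine response times to a discrete set. -/
theorem demand_eq_sum_nat_mul (hP : P.Valid A) (a y : ℝ) :
    ∃ N : Fin (k + 1) → ℕ, demand A P a y = ∑ i, (N i : ℝ) * A.C i 0 := by
  classical
  refine ⟨fun i => ((finite_higherJobs hP a y).toFinset.filter fun J => J.1 = i).card, ?_⟩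
  rw [demand_eq_sum hP, ← Finset.sum_fiberwise _ (fun J : Job (k + 1) => J.1)]
  refine Finset.sum_congr rfl fun i _ => ?_
  rw [← nsmul_eq_mul, ← Finset.sum_const]
  refine Finset.sum_congr rfl fun J hJ => ?_
  rw [(Finset.mem_filter.1 hJ).2]

/-- The response time of a job of the lowest-priority task that suffers no interference, in the
worst case. -/
noncomputable def baseResponse (A : TaskSystem (k + 1)) : ℝ :=
  ∑ j ∈ Finset.range (A.seg (Fin.last k)), A.C (Fin.last k) j +
    ∑ j ∈ Finset.range (A.seg (Fin.last k) - 1), A.S (Fin.last k) j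

/-- The pattern with worst-case parameters in which the lowest-priority task releases a job at
`0` and the windows `[a j, b j)` of the other tasks' releases are moved to start at `s j`. -/
noncomputable def shiftedPattern (A : TaskSystem (k + 1)) (P : ReleasePattern (k + 1))
    (a b s : ℕ → ℝ) : ReleasePattern (k + 1) where
  releases i := if i = Fin.last k then {0} else
    {y | ∃ j < A.seg (Fin.last k), ∃ x ∈ P.releases i, a j ≤ x ∧ x < b j ∧ y = x - a j + s j}
  exec i _ j := A.C i j
  susp i _ j := A.S i j

theorem shiftedPattern_releases_last (a b s : ℕ → ℝ) :
    (shiftedPattern A P a b s).releases (Fin.last k) = {0} := if_pos rfl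

theorem mem_shiftedPattern_releases {a b s : ℕ → ℝ} {i : Fin (k + 1)} (hi : i ≠ Fin.last k)
    {y : ℝ} : y ∈ (shiftedPattern A P a b s).releases i ↔
      ∃ j < A.seg (Fin.last k), ∃ x ∈ P.releases i, a j ≤ x ∧ x < b j ∧ y = x - a j + s j := by
  simp [shiftedPattern, hi]

theorem finite_shiftedPattern_releases (hP : P.Valid A) (a b s : ℕ → ℝ) (i : Fin (k + 1)) :
    ((shiftedPattern A P a b s).releases i).Finite := by
  by_cases hi : i = Fin.last k
  · rw [hi, shiftedPattern_releases_last]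
    exact Set.finite_singleton 0
  · refine ((Set.finite_Iio (A.seg (Fin.last k))).biUnion fun j _ =>
      (hP.finite_releases i (b j)).image fun x => x - a j + s j).subset fun y hy => ?_
    obtain ⟨j, hj, x, hx, -, h2, rfl⟩ := (mem_shiftedPattern_releases hi).1 hy
    exact Set.mem_biUnion (Set.mem_Iio.2 hj) ⟨x, ⟨hx, h2.le⟩, rfl⟩

/-- Each window is stretched to the full time its work needs, and each gap to the full suspension.
Neither operation brings releases closer together or shortens the response. -/
theorem exists_isCritical_of_windows (hP : P.Valid A)
    (hhigh : ∀ i, i ≠ Fin.last k → A.seg i = 1) {a b : ℕ → ℝ}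
    (hab : ∀ j < A.seg (Fin.last k), a j ≤ b j)
    (hba : ∀ j, j + 1 < A.seg (Fin.last k) → b j ≤ a (j + 1))
    (hgap : ∀ j, j + 1 < A.seg (Fin.last k) → a (j + 1) ≤ b j + A.S (Fin.last k) j)
    (hlt : ∀ j < A.seg (Fin.last k), ∀ x, a j ≤ x → x < b j →
      x - a j < A.C (Fin.last k) j + demand A P (a j) x) :
    ∃ (P' : ReleasePattern (k + 1)) (σ : Schedule (k + 1)) (v : ℝ),
      IsCritical A P' σ (Fin.last k) 0 ∧ responseTime A P' σ (Fin.last k, 0) = v ∧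
      b (A.seg (Fin.last k) - 1) - a 0 ≤ v ∧
      ∃ N : Fin (k + 1) → ℕ, v = baseResponse A + ∑ i, (N i : ℝ) * A.C i 0 := by
  set m := A.seg (Fin.last k) with hm
  have hmpos : 0 < m := A.seg_pos _
  set d : ℕ → ℝ := fun j => demand A P (a j) (b j) with hd
  set l : ℕ → ℝ := fun j => A.C (Fin.last k) j + d j with hl
  set s : ℕ → ℝ := fun j => ∑ j' ∈ Finset.range j, (l j' + A.S (Fin.last k) j') with hs
  have hs0 : s 0 = 0 := by simp [hs]
  have hstep : ∀ j, s (j + 1) = s j + l j + A.S (Fin.last k) j := fun j => by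
    simp only [hs, Finset.sum_range_succ, add_assoc]
  have hd0 : ∀ j, 0 ≤ d j := fun j => demand_nonneg _ _ _ _
  have hlpos : ∀ j < m, 0 < l j := fun j hj =>
    add_pos_of_pos_of_nonneg (A.C_pos _ _ hj) (hd0 j)
  -- `hlt` holds only strictly inside the window, so the endpoint is reached by approximating `b j -
  -- a j` from below and using monotonicity of the demand.
  have hlen : ∀ j < m, b j - a j ≤ l j := by
    intro j hj
    refine le_of_forall_lt fun c hc => ?_
    rcases lt_or_ge c 0 with h | h
    · exact h.trans (hlpos j hj)
    · have h1 := hlt j hj (c + a j) (by linarith) (by linarith)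
      have h2 := demand_mono (A := A) hP (a j) (x := c + a j) (y := b j) (by linarith)
      simp only [hl, hd]
      linarith
  have hord : ∀ {j j' : ℕ}, j < j' → j' < m → s j + l j ≤ s j' := fun h h' =>
    add_le_of_lt_of_step (fun j hj => (hlpos j hj).le)
      (fun j hj => by rw [hstep]; linarith [A.S_nonneg _ _ hj]) h h'
  have hordab : ∀ {j j' : ℕ}, j < j' → j' < m → b j ≤ a j' := fun {j j'} h h' => by
    have := add_le_of_lt_of_step (m := m) (s := a) (l := fun j => b j - a j)
      (fun j hj => sub_nonneg.2 (hab j hj)) (fun j hj => by linarith [hba j hj]) h h'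
    linarith
  -- Later windows are moved at least as far as earlier ones. This gives both the inter-arrival
  -- condition and the bound on the response time.
  have hshift : ∀ {j j' : ℕ}, j ≤ j' → j' < m → s j - a j ≤ s j' - a j' := by
    intro j j' h
    induction j', h using Nat.le_induction with
    | base => exact fun _ => le_rfl
    | succ i hi ih =>
      intro hi'
      have h1 := ih (by omega)
      rw [hstep]
      linarith [hgap i hi', hlen i (by omega)]
  have hs_nonneg : ∀ j < m, 0 ≤ s j := by
    intro j hj
    rcases Nat.eq_zero_or_pos j with rfl | h
    · exact hs0.ge
    · linarith [hord h hj, hlpos 0 (by omega)]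
  set P' := shiftedPattern A P a b s with hP'def
  have hP' : P'.Valid A := by
    refine ⟨fun i x hx => ?_, fun i x hx y hy hxy => ?_,
      fun i x _ j hj => ⟨(A.C_pos i j hj).le, le_rfl⟩,
      fun i x _ j hj => ⟨A.S_nonneg i j hj, le_rfl⟩⟩
    · by_cases hi : i = Fin.last k
      · rw [hi, shiftedPattern_releases_last] at hx
        exact (Set.mem_singleton_iff.1 hx).ge
      · obtain ⟨j, hj, x, -, h1, -, rfl⟩ := (mem_shiftedPattern_releases hi).1 hx
        linarith [hs_nonneg j hj]
    · by_cases hi : i = Fin.last k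
      · rw [hi, shiftedPattern_releases_last] at hx hy
        rw [Set.mem_singleton_iff.1 hx, Set.mem_singleton_iff.1 hy] at hxy
        exact absurd hxy (lt_irrefl _)
      · obtain ⟨j, hj, x, hx', h1, h2, rfl⟩ := (mem_shiftedPattern_releases hi).1 hx
        obtain ⟨j', hj', y, hy', h3, h4, rfl⟩ := (mem_shiftedPattern_releases hi).1 hy
        have hjj' : j ≤ j' := by
          by_contra! h
          linarith [hord h hj, hlen j' hj']
        have hxy' : x < y := by
          rcases hjj'.lt_or_eq with h | rfl
          · linarith [hordab h hj']
          · linarith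
        linarith [hP.separation i x hx' y hy' hxy', hshift hjj' hj']
  obtain ⟨σ, hσ⟩ := exists_isFPSchedule A P' fun i => finite_shiftedPattern_releases hP a b s i
  -- Translation matches the jobs of window `j`. The minimum with `b j` appears because the
  -- stretched part of the new window contains no releases.
  have hdem : ∀ j < m, ∀ y, s j ≤ y → y ≤ s j + l j →
      demand A P' (s j) y = demand A P (a j) (min (y - s j + a j) (b j)) := by
    intro j hj y _ hyl
    symm
    refine finsum_mem_eq_of_bijOn (fun J => (J.1, J.2 - a j + s j)) ⟨?_, ?_, ?_⟩ fun _ _ => rfl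
    · rintro J ⟨h1, h2, h3, h4⟩
      have h5 := lt_min_iff.1 h4
      exact ⟨h1, (mem_shiftedPattern_releases h1.ne).2 ⟨j, hj, J.2, h2, h3, h5.2, rfl⟩,
        by simpa using h3, by dsimp only; linarith [h5.1]⟩
    · intro J _ J' _ h
      have h1 := congrArg Prod.fst h
      have h2 := congrArg Prod.snd h
      dsimp only at h1 h2
      exact Prod.ext h1 (by linarith)
    · rintro ⟨i, z⟩ ⟨h1, h2, h3, h4⟩
      obtain ⟨j', hj', x, hx, h5, h6, h7⟩ := (mem_shiftedPattern_releases h1.ne).1 h2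
      dsimp only at h1 h2 h3 h4 h7 hx
      have hjj : j' = j := by
        rcases lt_trichotomy j' j with h | h | h
        · linarith [hord h hj, hlen j' hj']
        · exact h
        · linarith [hord h hj']
      subst hjj
      refine ⟨(i, x), ⟨h1, hx, h5, lt_min (by dsimp only; linarith) h6⟩, ?_⟩
      rw [h7]
  have hdem_full : ∀ j < m, ∀ y, b j - a j ≤ y - s j → s j ≤ y → y ≤ s j + l j →
      demand A P' (s j) y = d j := fun j hj y h1 h2 h3 => by
    rw [hdem j hj y h2 h3, min_eq_right (by linarith)]
  have htimes : ∀ j < m, segArrival P' σ (Fin.last k, 0) j = s j ∧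
      segFinish P' σ (Fin.last k, 0) j = (s j + l j : ℝ) := by
    intro j hj
    refine segArrival_eq_of_windows hP' hhigh hσ (shiftedPattern_releases_last a b s)
      (fun _ _ _ _ _ => rfl) (fun _ _ => rfl) hs0 (fun j _ => hstep j) ?_ ?_ ?_ hj
    · intro j hj
      rw [hdem_full j hj _ (by linarith [hlen j hj]) (by linarith [hlpos j hj]) le_rfl]
    · intro i hi x hx
      obtain ⟨j, hj, x, -, h1, h2, rfl⟩ := (mem_shiftedPattern_releases hi.ne).1 hx
      exact ⟨j, hj, by linarith, by linarith [hlen j hj]⟩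
    · intro j hj x h1 h2
      rcases lt_or_ge (x - s j + a j) (b j) with h | h
      · rw [hdem j hj x h1 h2.le, min_eq_left h.le]
        have := hlt j hj (x - s j + a j) (by linarith) h
        linarith
      · rw [hdem_full j hj x (by linarith) h1 h2.le]
        have : l j = A.C (Fin.last k) j + d j := rfl
        linarith
  have hlast : m - 1 < m := by omega
  refine ⟨P', σ, s (m - 1) + l (m - 1), ⟨hP', hσ, shiftedPattern_releases_last a b s,
    fun i hi x hx => ?_, fun j hj => ?_, fun _ _ _ _ _ => rfl⟩, ?_, ?_, ?_⟩
  · obtain ⟨j, hj, x, -, h1, h2, rfl⟩ := (mem_shiftedPattern_releases hi.ne).1 hx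
    refine ⟨j, hj, ?_⟩
    rw [(htimes j hj).1, (htimes j hj).2, EReal.coe_le_coe_iff, EReal.coe_lt_coe_iff]
    exact ⟨by linarith, by linarith [hlen j hj]⟩
  · rw [(htimes (j + 1) hj).1, (htimes j (by omega)).2, ← EReal.coe_sub, hstep]
    congr 1
    ring
  · unfold responseTime
    rw [(htimes (m - 1) hlast).2]
    simp
  · have h1 := hshift (Nat.zero_le (m - 1)) hlast
    rw [hs0] at h1
    linarith [hlen (m - 1) hlast]
  · choose N hN using fun j => demand_eq_sum_nat_mul (A := A) hP (a j) (b j)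
    refine ⟨fun i => ∑ j ∈ Finset.range m, N j i, ?_⟩
    have h1 : ∑ i, ((∑ j ∈ Finset.range m, N j i : ℕ) : ℝ) * A.C i 0 =
        ∑ j ∈ Finset.range m, d j := by
      simp only [Nat.cast_sum, Finset.sum_mul]
      rw [Finset.sum_comm]
      exact Finset.sum_congr rfl fun j _ => (hN j).symm
    rw [h1]
    obtain ⟨m', hm'⟩ : ∃ m', m = m' + 1 := ⟨m - 1, by omega⟩
    simp only [baseResponse, ← hm, hm', Nat.add_sub_cancel, Finset.sum_range_succ, hs, hl,
      Finset.sum_add_distrib]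
    ring

end Shift

/-! ### From an arbitrary job to a critical pattern. -/

section Extraction

variable {k : ℕ} {A : TaskSystem (k + 1)} {P : ReleasePattern (k + 1)} {σ : Schedule (k + 1)}

/-- Time `0` is clear, and a supremum of clear times is clear because the condition concerns only
strictly earlier releases. -/
theorem exists_last_clear (hP : P.Valid A) (σ : Schedule (k + 1)) {c : ℝ} (hc : 0 ≤ c) :
    ∃ a ≤ c, Clear P σ a ∧ ∀ u, Clear P σ u → u ≤ c → u ≤ a := by
  have hne : {t | t ≤ c ∧ Clear P σ t}.Nonempty :=
    ⟨0, hc, fun J _ h h' => absurd h' (not_lt.2 (hP.release_nonneg _ _ h))⟩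
  have hbdd : BddAbove {t | t ≤ c ∧ Clear P σ t} := ⟨c, fun t h => h.1⟩
  refine ⟨sSup {t | t ≤ c ∧ Clear P σ t}, csSup_le hne fun t h => h.1, fun J h1 h2 h3 => ?_,
    fun u hu huc => le_csSup hbdd ⟨huc, hu⟩⟩
  obtain ⟨t, ht, hJt⟩ := exists_lt_of_lt_csSup hne h3
  exact (ht.2 J h1 h2 hJt).trans (EReal.coe_le_coe_iff.2 (le_csSup hbdd ht))

theorem exists_running_of_not_clear (hP : P.Valid A)
    (hhigh : ∀ i, i ≠ Fin.last k → A.seg i = 1) (hσ : IsFPSchedule A P σ) {u : ℝ}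
    (hu : ¬ Clear P σ u) : ∃ J : Job (k + 1), J.1 < Fin.last k ∧ σ u = some J := by
  unfold Clear at hu
  push Not at hu
  obtain ⟨J, h1, h2, h3, h4⟩ := hu
  obtain ⟨J', hJ', -, h⟩ := hσ.exists_running hP
    ((ready_iff_of_seg_eq_one (hhigh _ h1.ne)).2 ⟨h2, h3.le, h4⟩)
  refine ⟨J', ?_, hJ'⟩
  rcases h with rfl | h | ⟨h, -⟩
  · exact h1
  · exact h.trans h1
  · exact h ▸ h1

theorem exists_coe_eq_min {x : EReal} {r t : ℝ} (h : (r : EReal) ≤ x) (hrt : r ≤ t) :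
    ((min x (t : EReal)).toReal : EReal) = min x (t : EReal) :=
  EReal.coe_toReal (ne_top_of_le_ne_top (EReal.coe_ne_top t) (min_le_right _ _))
    (ne_bot_of_le_ne_bot (EReal.coe_ne_bot r) (le_min h (EReal.coe_le_coe_iff.2 hrt)))

/-- The cut at `t` keeps all times real even if the job never finishes. Moving each window start
back to the last clear time takes in the backlog present when the segment arrives. -/
theorem exists_isCritical_of_le_segFinish (hP : P.Valid A)
    (hhigh : ∀ i, i ≠ Fin.last k → A.seg i = 1) (hσ : IsFPSchedule A P σ) {r t : ℝ}
    (hr : r ∈ P.releases (Fin.last k))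
    (hprev : ∀ r' ∈ P.releases (Fin.last k), r' < r →
      segFinish P σ (Fin.last k, r') (A.seg (Fin.last k) - 1) ≤ r)
    (hrt : r ≤ t) (ht : (t : EReal) ≤ segFinish P σ (Fin.last k, r) (A.seg (Fin.last k) - 1)) :
    ∃ (P' : ReleasePattern (k + 1)) (σ' : Schedule (k + 1)) (v : ℝ),
      IsCritical A P' σ' (Fin.last k) 0 ∧ responseTime A P' σ' (Fin.last k, 0) = v ∧
      t - r ≤ v ∧ ∃ N : Fin (k + 1) → ℕ, v = baseResponse A + ∑ i, (N i : ℝ) * A.C i 0 := by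
  set J : Job (k + 1) := (Fin.last k, r) with hJ
  set m := A.seg (Fin.last k) with hm
  have hmpos : 0 < m := A.seg_pos _
  set g : ℕ → ℝ := fun j => (min (segArrival P σ J j) (t : EReal)).toReal with hgdef
  set f : ℕ → ℝ := fun j => (min (segFinish P σ J j) (t : EReal)).toReal with hfdef
  have hrarr : ∀ j < m, (r : EReal) ≤ segArrival P σ J j := fun j hj =>
    release_le_segArrival hP (J := J) hr hj
  have hg : ∀ j < m, (g j : EReal) = min (segArrival P σ J j) t := fun j hj =>
    exists_coe_eq_min (hrarr j hj) hrt
  have hf : ∀ j < m, (f j : EReal) = min (segFinish P σ J j) t := fun j hj =>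
    exists_coe_eq_min ((hrarr j hj).trans (segArrival_le_segFinish J j)) hrt
  have hgf : ∀ j < m, g j ≤ f j := fun j hj => by
    rw [← EReal.coe_le_coe_iff, hg j hj, hf j hj]
    exact min_le_min_right _ (segArrival_le_segFinish J j)
  have hfg : ∀ j, j + 1 < m → f j ≤ g (j + 1) := fun j hj => by
    rw [← EReal.coe_le_coe_iff, hg _ hj, hf j (by omega)]
    exact min_le_min_right _ (segFinish_le_segArrival_succ hP (J := J) hr hj)
  have hgS : ∀ j, j + 1 < m → g (j + 1) ≤ f j + A.S (Fin.last k) j := fun j hj => by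
    have hsusp := hP.susp_mem _ r hr j hj
    rw [← EReal.coe_le_coe_iff, EReal.coe_add, hg _ hj, hf j (by omega), segArrival_succ]
    rcases le_total (segFinish P σ J j) t with h | h
    · rw [min_eq_left h]
      exact (min_le_left _ _).trans (add_le_add_right (EReal.coe_le_coe_iff.2 hsusp.2) _)
    · rw [min_eq_right h]
      exact (min_le_right _ _).trans
        (le_add_of_nonneg_right (EReal.coe_nonneg.2 (A.S_nonneg _ _ hj)))
  have hr0 : 0 ≤ r := hP.release_nonneg _ _ hr
  have hrg : ∀ j < m, r ≤ g j := fun j hj => by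
    rw [← EReal.coe_le_coe_iff, hg j hj]
    exact le_min (hrarr j hj) (EReal.coe_le_coe_iff.2 hrt)
  have hex : ∀ j, ∃ a, j < m → a ≤ g j ∧ Clear P σ a ∧ ∀ u, Clear P σ u → u ≤ g j → u ≤ a := by
    intro j
    by_cases hj : j < m
    · obtain ⟨a, h1, h2, h3⟩ := exists_last_clear hP σ (hr0.trans (hrg j hj))
      exact ⟨a, fun _ => ⟨h1, h2, h3⟩⟩
    · exact ⟨0, fun h => absurd h hj⟩
  choose a ha using hex
  have hamono : ∀ j, j + 1 < m → a j ≤ a (j + 1) := fun j hj =>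
    (ha (j + 1) hj).2.2 _ (ha j (by omega)).2.1
      ((ha j (by omega)).1.trans ((hgf j (by omega)).trans (hfg j hj)))
  -- The minimum keeps the windows disjoint, since `a (j + 1)` may lie before `f j`; the last window
  -- has no successor and must end at `t`.
  set b : ℕ → ℝ := fun j => if j + 1 < m then min (f j) (a (j + 1)) else f j with hb
  have hbf : ∀ j, b j ≤ f j := fun j => by
    simp only [hb]
    split_ifs
    · exact min_le_left _ _
    · exact le_rfl
  obtain ⟨P', σ', v, hcrit, hv, hle, hN⟩ := exists_isCritical_of_windows hP hhigh (a := a) (b := b)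
    (fun j hj => by
      have h1 := (ha j hj).1.trans (hgf j hj)
      simp only [hb]
      split_ifs with h
      · exact le_min h1 (hamono j h)
      · exact h1)
    (fun j hj => by
      simp only [hb, if_pos (show j + 1 < m from hj)]
      exact min_le_right _ _)
    (fun j hj => by
      simp only [hb, if_pos (show j + 1 < m from hj)]
      have h1 := (ha (j + 1) hj).1.trans (hgS j hj)
      have h2 := A.S_nonneg _ _ hj
      rcases min_cases (f j) (a (j + 1)) with h | h <;> linarith [h.1])
    (fun j hj x hax hxb => by
      have hxf : x < f j := hxb.trans_le (hbf j)
      have hxlt : (x : EReal) < min (segFinish P σ J j) t := by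
        rw [← hf j hj]; exact EReal.coe_lt_coe_iff.2 hxf
      have hxt : x < t := EReal.coe_lt_coe_iff.1 (hxlt.trans_le (min_le_right _ _))
      have hxF : (x : EReal) < segFinish P σ J j := hxlt.trans_le (min_le_left _ _)
      have harr : ∀ u, g j ≤ u → u ≤ x → segArrival P σ J j = (g j : EReal) := by
        intro u h1 h2
        rcases min_choice (segArrival P σ J j) (t : EReal) with h | h
        · rw [hg j hj, h]
        · have := hg j hj
          rw [h, EReal.coe_eq_coe_iff] at this
          linarith
      -- Between `a j` and `g j` no time is clear, so higher-priority work runs. After `g j` segment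
      -- `j` is ready, and earlier jobs of its own task are excluded by `hprev`.
      have h1 := ofReal_sub_le_service_add_demand (J := J) (y := x) (g := g j) hP hhigh hσ
        (ha j hj).2.1 (fun u hu => by
          rcases le_or_gt u (g j) with hug | hug
          · left
            refine exists_running_of_not_clear hP hhigh hσ fun hcl => ?_
            exact absurd ((ha j hj).2.2 u hcl hug) (not_le.2 hu.1)
          · have hready : Ready A P σ J u := ⟨hr, j, hj, by
              rw [harr u hug.le hu.2.le]; exact EReal.coe_le_coe_iff.2 hug.le,
              (EReal.coe_lt_coe_iff.2 hu.2).trans hxF⟩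
            obtain ⟨J', hJ', ⟨hrel, j', hj', -, hfin⟩, rfl | h | ⟨h, h'⟩⟩ :=
              hσ.exists_running hP hready
            · exact Or.inr ⟨hug.le, hJ'⟩
            · exact Or.inl ⟨J', h, hJ'⟩
            · obtain ⟨i, r'⟩ := J'
              dsimp only at h h' hrel hj' hfin
              change i = Fin.last k at h
              subst h
              have h2 := segFinish_mono (σ := σ) hP (J := (Fin.last k, r')) hrel
                (Nat.le_sub_one_of_lt hj') (Nat.sub_lt hmpos one_pos)
              have h3 := EReal.coe_lt_coe_iff.1 (hfin.trans_le (h2.trans (hprev r' hrel h')))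
              linarith [hrg j hj])
      have h2 : service σ J (g j) x < ENNReal.ofReal (A.C (Fin.last k) j) := by
        rcases le_or_gt (g j) x with hgx | hgx
        · have h3 := hxF
          unfold segFinish at h3
          rw [harr x hgx le_rfl, lt_finishFrom_iff hgx] at h3
          exact h3.trans_le (ENNReal.ofReal_le_ofReal (hP.exec_mem _ r hr j hj).2)
        · rw [service_eq_zero hgx.le]
          exact ENNReal.ofReal_pos.2 (A.C_pos _ _ hj)
      have h3 := h1.trans_lt (ENNReal.add_lt_add_of_lt_of_le ENNReal.ofReal_ne_top h2 le_rfl)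
      rw [← ENNReal.ofReal_add (A.C_pos _ _ hj).le (demand_nonneg _ _ _ _)] at h3
      exact (ENNReal.ofReal_lt_ofReal_iff_of_nonneg (by linarith)).1 h3)
  refine ⟨P', σ', v, hcrit, hv, le_trans ?_ hle, hN⟩
  have hblast : b (m - 1) = t := by
    simp only [hb, if_neg (show ¬ m - 1 + 1 < m by omega)]
    rw [← EReal.coe_eq_coe_iff, hf _ (by omega), min_eq_right ht]
  have hg0 : g 0 = r := by
    rw [← EReal.coe_eq_coe_iff, hg 0 hmpos]
    exact min_eq_left (EReal.coe_le_coe_iff.2 hrt)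
  rw [← hm, hblast]
  linarith [(ha 0 hmpos).1]

/-- Predecessors with response time at most `T_n` are finished by `r` because releases are `T_n`
apart. A real cut `t` strictly between `R + r` and the completion turns the weak bound into a strict
one and also covers infinite response times. -/
theorem exists_isCritical_of_lt_responseTime (hP : P.Valid A)
    (hhigh : ∀ i, i ≠ Fin.last k → A.seg i = 1) (hσ : IsFPSchedule A P σ) {r R : ℝ}
    (hr : r ∈ P.releases (Fin.last k))
    (hprev : ∀ r' ∈ P.releases (Fin.last k), r' < r →
      responseTime A P σ (Fin.last k, r') ≤ (A.T (Fin.last k) : EReal))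
    (hR : 0 ≤ R) (hlt : (R : EReal) < responseTime A P σ (Fin.last k, r)) :
    ∃ (P' : ReleasePattern (k + 1)) (σ' : Schedule (k + 1)) (v : ℝ),
      IsCritical A P' σ' (Fin.last k) 0 ∧ responseTime A P' σ' (Fin.last k, 0) = v ∧
      R < v ∧ ∃ N : Fin (k + 1) → ℕ, v = baseResponse A + ∑ i, (N i : ℝ) * A.C i 0 := by
  have h1 : ((R + r : ℝ) : EReal) <
      segFinish P σ (Fin.last k, r) (A.seg (Fin.last k) - 1) := by
    rw [EReal.coe_add]
    exact EReal.add_lt_of_lt_sub hlt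
  obtain ⟨t, ht1, ht2⟩ := EReal.lt_iff_exists_real_btwn.1 h1
  rw [EReal.coe_lt_coe_iff] at ht1
  obtain ⟨P', σ', v, hcrit, hv, hle, hN⟩ := exists_isCritical_of_le_segFinish hP hhigh hσ hr
    (fun r' hr' hlt' => by
      have h2 := hprev r' hr' hlt'
      have h3 := (EReal.sub_le_iff_le_add (Or.inl (EReal.coe_ne_bot _))
        (Or.inl (EReal.coe_ne_top _))).1 h2
      refine h3.trans ?_
      rw [← EReal.coe_add, EReal.coe_le_coe_iff]
      dsimp only
      linarith [hP.separation _ r' hr' r hr hlt']) (by linarith) ht2.le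
  exact ⟨P', σ', v, hcrit, hv, by linarith, hN⟩

theorem responseTime_le_WCRT {n : ℕ} {A : TaskSystem n} {P : ReleasePattern n} {σ : Schedule n}
    {i : Fin n} {r : ℝ} (hP : P.Valid A) (hσ : IsFPSchedule A P σ) (hr : r ∈ P.releases i) :
    responseTime A P σ (i, r) ≤ WCRT A i :=
  le_sSup ⟨P, σ, r, hP, hσ, hr, rfl⟩

theorem IsCritical.responseTime_le_WCRT {n : ℕ} {A : TaskSystem n} {P : ReleasePattern n}
    {σ : Schedule n} {i : Fin n} {r : ℝ} (h : IsCritical A P σ i r) :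
    responseTime A P σ (i, r) ≤ WCRT A i :=
  _root_.responseTime_le_WCRT h.valid h.schedule (by rw [h.only_job]; rfl)

theorem baseResponse_nonneg (A : TaskSystem (k + 1)) : 0 ≤ baseResponse A := by
  refine add_nonneg (Finset.sum_nonneg fun j hj => (A.C_pos _ _ (Finset.mem_range.1 hj)).le)
    (Finset.sum_nonneg fun j hj => A.S_nonneg _ _ ?_)
  have := Finset.mem_range.1 hj
  omega

theorem finite_sum_nat_mul_le {ι : Type*} [Fintype ι] {c : ι → ℝ} (hc : ∀ i, 0 < c i)
    (w : ℝ) {B : ℝ} (hB : 0 ≤ B) :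
    {v : ℝ | v ≤ w ∧ ∃ N : ι → ℕ, v = B + ∑ i, (N i : ℝ) * c i}.Finite := by
  classical
  refine ((Set.finite_Icc (0 : ι → ℕ) fun i => ⌊w / c i⌋₊).image
    fun N => B + ∑ i, (N i : ℝ) * c i).subset ?_
  rintro v ⟨hv, N, rfl⟩
  refine ⟨N, ⟨fun i => Nat.zero_le _, fun i => Nat.le_floor ?_⟩, rfl⟩
  rw [le_div_iff₀ (hc i)]
  have := Finset.single_le_sum (f := fun i => (N i : ℝ) * c i)
    (fun i _ => mul_nonneg (Nat.cast_nonneg _) (hc i).le) (Finset.mem_univ i)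
  linarith

/-- Empty windows in the empty pattern: the job runs without interference. -/
theorem exists_isCritical (A : TaskSystem (k + 1)) (hhigh : ∀ i, i ≠ Fin.last k → A.seg i = 1) :
    ∃ (P : ReleasePattern (k + 1)) (σ : Schedule (k + 1)) (v : ℝ),
      IsCritical A P σ (Fin.last k) 0 ∧ responseTime A P σ (Fin.last k, 0) = v ∧
      ∃ N : Fin (k + 1) → ℕ, v = baseResponse A + ∑ i, (N i : ℝ) * A.C i 0 := by
  have hP : ReleasePattern.Valid A ⟨fun _ => ∅, fun _ _ _ => 0, fun _ _ _ => 0⟩ :=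
    ⟨by simp, by simp, by simp, by simp⟩
  obtain ⟨P, σ, v, h1, h2, -, h3⟩ := exists_isCritical_of_windows hP hhigh (a := 0) (b := 0)
    (fun _ _ => le_rfl) (fun _ _ => le_rfl)
    (fun j hj => by simpa using A.S_nonneg _ _ hj)
    (fun _ _ x h h' => absurd h' (not_lt.2 h))
  exact ⟨P, σ, v, h1, h2, h3⟩

end Extraction

theorem mainTheorem9 {k : ℕ} (A : TaskSystem (k + 1))
    (hlow : 2 ≤ A.seg (Fin.last k))
    (hhigh : ∀ i, i ≠ Fin.last k → A.seg i = 1) :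
    (WCRT A (Fin.last k) ≤ (A.T (Fin.last k) : EReal) →
      IsGreatest {x : EReal | ∃ (P : ReleasePattern (k + 1)) (σ : Schedule (k + 1)) (r : ℝ),
          IsCritical A P σ (Fin.last k) r ∧ x = responseTime A P σ (Fin.last k, r)}
        (WCRT A (Fin.last k))) ∧
    ((A.T (Fin.last k) : EReal) < WCRT A (Fin.last k) →
      ∃ (P : ReleasePattern (k + 1)) (σ : Schedule (k + 1)) (r : ℝ),
        IsCritical A P σ (Fin.last k) r ∧
        (A.T (Fin.last k) : EReal) < responseTime A P σ (Fin.last k, r) ∧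
        responseTime A P σ (Fin.last k, r) < ⊤) := by
  constructor
  · intro hW
    refine ⟨?_, ?_⟩
    -- The discrete form of the values and the bound `T_n` make `V` finite, so it has a maximum. Any
    -- larger response time in a valid pattern would yield a larger element of `V`.
    · set V : Set ℝ := {v | (v ≤ A.T (Fin.last k) ∧
          ∃ N : Fin (k + 1) → ℕ, v = baseResponse A + ∑ i, (N i : ℝ) * A.C i 0) ∧
        ∃ (P : ReleasePattern (k + 1)) (σ : Schedule (k + 1)),
          IsCritical A P σ (Fin.last k) 0 ∧ responseTime A P σ (Fin.last k, 0) = v} with hV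
      have hVfin : V.Finite := (finite_sum_nat_mul_le A.C_zero_pos _
        (baseResponse_nonneg A)).subset fun v hv => hv.1
      have hmem : ∀ {P σ} {v : ℝ}, IsCritical A P σ (Fin.last k) 0 →
          responseTime A P σ (Fin.last k, 0) = v →
          (∃ N : Fin (k + 1) → ℕ, v = baseResponse A + ∑ i, (N i : ℝ) * A.C i 0) → v ∈ V := by
        intro P σ v hc hv hN
        refine ⟨⟨?_, hN⟩, P, σ, hc, hv⟩
        rw [← EReal.coe_le_coe_iff, ← hv]
        exact hc.responseTime_le_WCRT.trans hW
      have hVne : V.Nonempty := by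
        obtain ⟨P, σ, v, hc, hv, hN⟩ := exists_isCritical A hhigh
        exact ⟨v, hmem hc hv hN⟩
      obtain ⟨M, hM, hmax⟩ := Set.exists_max_image V id hVfin hVne
      have hM0 : 0 ≤ M := by
        obtain ⟨N, hN⟩ := hM.1.2
        rw [hN]
        exact add_nonneg (baseResponse_nonneg A) (Finset.sum_nonneg fun i _ =>
          mul_nonneg (Nat.cast_nonneg _) (A.C_zero_pos i).le)
      obtain ⟨P, σ, hc, hv⟩ := hM.2
      refine ⟨P, σ, 0, hc, le_antisymm ?_ hc.responseTime_le_WCRT⟩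
      rw [hv]
      refine sSup_le ?_
      rintro x ⟨P', σ', r, hP', hσ', hr, rfl⟩
      by_contra! hlt
      obtain ⟨P'', σ'', v, hc', hv', hMv, hN⟩ := exists_isCritical_of_lt_responseTime hP' hhigh hσ'
        hr (fun r' hr' _ => (responseTime_le_WCRT hP' hσ' hr').trans hW) hM0 hlt
      exact absurd (hmax v (hmem hc' hv' hN)) (not_le.2 hMv)
    · rintro x ⟨P, σ, r, hc, rfl⟩
      exact hc.responseTime_le_WCRT
  · intro hW
    obtain ⟨x, ⟨P, σ, r₀, hP, hσ, hr₀, rfl⟩, hlt⟩ := lt_sSup_iff.1 hW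
    -- The earliest job exceeding `T_n` is needed: only then are all its predecessors finished in
    -- time.
    obtain ⟨r, ⟨⟨hr, hr1⟩, hr2⟩, hmin⟩ := Set.exists_min_image
      {r | (r ∈ P.releases (Fin.last k) ∧ r ≤ r₀) ∧
        (A.T (Fin.last k) : EReal) < responseTime A P σ (Fin.last k, r)} id
      ((hP.finite_releases (Fin.last k) r₀).subset fun r h => h.1) ⟨r₀, ⟨hr₀, le_rfl⟩, hlt⟩
    obtain ⟨P', σ', v, hc, hv, hTv, -⟩ := exists_isCritical_of_lt_responseTime hP hhigh hσ hr
      (fun r' hr' h => by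
        by_contra! hcon
        exact absurd (hmin r' ⟨⟨hr', h.le.trans hr1⟩, hcon⟩) (not_le.2 h))
      (A.T_pos _).le hr2
    refine ⟨P', σ', 0, hc, ?_, ?_⟩
    · rw [hv]
      exact EReal.coe_lt_coe_iff.2 hTv
    · rw [hv]
      exact EReal.coe_lt_top v
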